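/- **Conventions.** A quantum set $(B,\psi)$ is a finite-dimensional C*-algebra $B$ with a faithful positive functional $\psi$ such that $m m^\ast=\mathrm{Id}_B$, where $m:B\otimes B\to B$ is the multiplication and $m^\ast$ is its adjoint for the inner products $\langle a,b\rangle_\psi=\psi(a^\ast b)$ on $B$ and $\langle\cdot,\cdot\rangle_{\psi\otimes\psi}$ on $B\otimes B$. A quantum graph on $(B,\psi)$ is a linear map $A:B\to B$ with $m(A\otimes A)m^\ast=A$ and $A(b^\ast)=A(b)^\ast$ for all $b\in B$. For quantum graphs $A_i$ on $(B_i,\psi_i)$, $i=1,2$, a quantum isomorphism from $A_1$ to $A_2$ is a unital $\ast$-homomorphism $\rho:B_1\to B_2\otimes B(\mathcal H)$, with $\mathcal H\neq 0$ a finite-dimensional Hilbert space, such that $L^2(B_1)\otimes\mathcal H\to L^2(B_2)\otimes\mathcal H$, $a\otimes\xi\mapsto\rho(a)(1\otimes\xi)$, is unitary and $\rho A_1=(A_2\otimes\mathrm{Id}_{B(\mathcal H)})\rho$. One writes $A_1\cong_q A_2$ if such a $\rho$ exists. Let $G$ be a finite abelian group, $n=|G|$, $(\tilde B,\tilde\psi)$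 a quantum set, and $\hat\alpha$ an action of the dual group $\hat G$ on $\tilde B$ by $\ast$-automorphisms with $\tilde\psi\circ\hat\alpha_\chi=\tilde\psi$ for all $\chi\in\hat G$. Let $B=\tilde B\rtimes_{\hat\alpha}\hat G$ be the crossed product, with elements $\sum_\chi b_\chi u_\chi$ ($b_\chi\in\tilde B$) and unitaries $u_\chi$ satisfying $u_\chi b u_\chi^\ast=\hat\alpha_\chi(b)$ for $b\in\tilde B$. Put $$\psi_\rtimes\Big(\sum_\chi b_\chi u_\chi\Big)=n\tilde\psi(b_1),\qquad E_\rtimes\Big(\sum_\chi b_\chi u_\chi\Big)=n b_1,\qquad X_g(b)=\frac1n\sum_{\chi\in\hat G}\overline{\chi(g)}\,\langle u_\chi,b\rangle_{\psi_\rtimes}u_\chi .$$ A voltage quantum graph on $(\tilde B,\tilde\psi)$ with respect to $\hat\alpha$ is a family $\tilde A=(\tilde A_g)_{g\in G}$ of quantum graphs on $(\tilde B,\tilde\psi)$ with $\tilde A_g\hat\alpha_\chi=\hat\alpha_\chi\tilde A_g$ for all $g\in G$, $\chi\in\hat G$. Its derived quantum graph is $$\tilde A\rtimes_{\hat\alpha}\hat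 G=\sum_{g\in G}m(X_g\otimes E_\rtimes^\ast\tilde A_gE_\rtimes)m^\ast:B\to B,$$ where $m,m^\ast$ are the multiplication of $B$ and its adjoint. For the trivial action, $\tilde B\rtimes_{\mathrm{triv}}\hat G$ is identified with $\tilde B\otimes C(G)$ by the $\ast$-isomorphism $\sum_\chi b_\chi u_\chi\mapsto\sum_\chi b_\chi\otimes\tilde u_\chi$, where $\tilde u_\chi(g)=\chi(g)$. Let $\psi_G(f)=\sum_{g\in G}f(g)$, let $L^2(G)$ be $C(G)$ with the inner product $\langle f,h\rangle=\psi_G(f^\ast h)$, let $e_\chi\in L^2(G)$ be $\tilde u_\chi$ viewed as a vector, and let $E_{\xi,\zeta}\in B(L^2(G))$ be the matrix units $E_{\xi,\zeta}e_\eta=\delta_{\zeta=\eta}e_\xi$. **Theorem.** Let $\tilde A$ be a voltage quantum graph on $(\tilde B,\tilde\psi)$ with respect to $\hat\alpha$. Then $(\tilde B\rtimes_{\hat\alpha}\hat G,\psi_\rtimes)$ and $(\tilde B\otimes C(G),\tilde\psi\otimes\psi_G)$ are quantum sets, the identification above carries $\psi_\rtimes$ (for the trivial action) to $\tilde\psi\otimes\psi_G$,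 and $\tilde A\rtimes_{\hat\alpha}\hat G$ and $\tilde A\rtimes_{\mathrm{triv}}\hat G$ are quantum graphs on these two quantum sets respectively. There is a unital $\ast$-homomorphism $$\rho:\tilde B\otimes C(G)\to(\tilde B\rtimes_{\hat\alpha}\hat G)\otimes B(L^2(G)),\qquad b\otimes\tilde u_\chi\mapsto\sum_{\zeta\in\hat G}u_\zeta b u_\zeta^\ast u_\chi\otimes E_{\zeta,\chi^{-1}\zeta},$$ and it is a quantum isomorphism from $\tilde A\rtimes_{\mathrm{triv}}\hat G$ (as a quantum graph on $\tilde B\otimes C(G)$) to $\tilde A\rtimes_{\hat\alpha}\hat G$. Moreover $$\tilde A\rtimes_{\hat\alpha}\hat G\cong_q\tilde A\rtimes_{\mathrm{triv}}\hat G .$$ -/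

import Mathlib

open scoped TensorProduct ComplexOrder

universe u v

set_option linter.unusedSectionVars false

namespace QGraph

noncomputable section

/-! ### Inner products induced by functionals, tensor products and adjoints -/

section Forms

variable {B : Type*} [Ring B] [StarRing B] [Algebra ℂ B] [StarModule ℂ B]

/-- The sesquilinear form `⟨a, b⟩_ψ = ψ (a⋆ b)` of a functional `ψ` on a `⋆`-algebra, conjugate
linear in the first and linear in the second argument. -/
def gnsForm (ψ : B →ₗ[ℂ] ℂ) : B →ₗ⋆[ℂ] B →ₗ[ℂ] ℂ :=
  LinearMap.mk₂'ₛₗ (starRingEnd ℂ) (RingHom.id ℂ) (fun a b => ψ (star a * b))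
    (by intros; simp [add_mul])
    (by intros; simp)
    (by intros; simp [mul_add])
    (by intros; simp)

@[simp]
lemma gnsForm_apply (ψ : B →ₗ[ℂ] ℂ) (a b : B) : gnsForm ψ a b = ψ (star a * b) := rfl

/-- `ψ` is a faithful positive functional. -/
structure IsFaithfulPositive (ψ : B →ₗ[ℂ] ℂ) : Prop where
  nonneg : ∀ a : B, 0 ≤ ψ (star a * a)
  faithful : ∀ a : B, ψ (star a * a) = 0 → a = 0

end Forms

section Modules

variable {V : Type*} [AddCommGroup V] [Module ℂ V] {W : Type*} [AddCommGroup W] [Module ℂ W]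

/-- The tensor product of two sesquilinear forms,
`⟨a ⊗ x, b ⊗ y⟩ = ⟨a, b⟩ ⟨x, y⟩`. -/
def tensorForm (s : V →ₗ⋆[ℂ] V →ₗ[ℂ] ℂ) (t : W →ₗ⋆[ℂ] W →ₗ[ℂ] ℂ) :
    (V ⊗[ℂ] W) →ₗ⋆[ℂ] (V ⊗[ℂ] W) →ₗ[ℂ] ℂ :=
  (TensorProduct.lift (TensorProduct.mapBilinear (.id ℂ) V W ℂ ℂ)).compr₂ (LinearMap.mul' ℂ ℂ)
    ∘ₛₗ TensorProduct.map s t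

@[simp]
lemma tensorForm_tmul (s : V →ₗ⋆[ℂ] V →ₗ[ℂ] ℂ) (t : W →ₗ⋆[ℂ] W →ₗ[ℂ] ℂ) (a b : V) (x y : W) :
    tensorForm s t (a ⊗ₜ[ℂ] x) (b ⊗ₜ[ℂ] y) = s a b * t x y := rfl

/-- `S` is adjoint to `T` for the forms `s` and `t`: `⟨T a, b⟩_t = ⟨a, S b⟩_s`. -/
def IsAdjoint (s : V →ₗ⋆[ℂ] V →ₗ[ℂ] ℂ) (t : W →ₗ⋆[ℂ] W →ₗ[ℂ] ℂ)
    (T : V →ₗ[ℂ] W) (S : W →ₗ[ℂ] V) : Prop :=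
  ∀ a b, t (T a) b = s a (S b)

open Classical in
/-- The adjoint of `T` for the forms `s` and `t`. If `V` is finite dimensional and `s` is an inner
product, then it exists and is unique. -/
def formAdjoint (s : V →ₗ⋆[ℂ] V →ₗ[ℂ] ℂ) (t : W →ₗ⋆[ℂ] W →ₗ[ℂ] ℂ) (T : V →ₗ[ℂ] W) :
    W →ₗ[ℂ] V :=
  if h : ∃ S, IsAdjoint s t T S then h.choose else 0

end Modules

/-! ### Quantum sets and quantum graphs -/

section QuantumSets

variable {B : Type*} [Ring B] [StarRing B] [Algebra ℂ B] [StarModule ℂ B]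

/-- The comultiplication `m⋆ : B → B ⊗ B`: the adjoint of the multiplication map `m` with respect
to `⟨·,·⟩_{ψ ⊗ ψ}` and `⟨·,·⟩_ψ`. -/
def comul (ψ : B →ₗ[ℂ] ℂ) : B →ₗ[ℂ] B ⊗[ℂ] B :=
  formAdjoint (tensorForm (gnsForm ψ) (gnsForm ψ)) (gnsForm ψ) (LinearMap.mul' ℂ B)

/-- `(B, ψ)` is a quantum set: `ψ` is a faithful positive functional on the finite dimensional
algebra `B` and `m m⋆ = id`. A finite dimensional unital complex `⋆`-algebra that carries a
faithful positive functional is a C⋆-algebra for exactly one norm (it acts faithfully on its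
GNS space), so that the norm need not be mentioned. -/
structure IsQuantumSet (ψ : B →ₗ[ℂ] ℂ) : Prop where
  finiteDimensional : FiniteDimensional ℂ B
  faithfulPositive : IsFaithfulPositive ψ
  mul_comul : LinearMap.mul' ℂ B ∘ₗ comul ψ = LinearMap.id

/-- The Schur product `m (S ⊗ T) m⋆` of two linear maps on a quantum set. -/
def schurProduct (ψ : B →ₗ[ℂ] ℂ) (S T : B →ₗ[ℂ] B) : B →ₗ[ℂ] B :=
  LinearMap.mul' ℂ B ∘ₗ TensorProduct.map S T ∘ₗ comul ψ

/-- `A` is a quantum adjacency matrix (a quantum graph) on `(B, ψ)`. -/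
structure IsQuantumGraph (ψ : B →ₗ[ℂ] ℂ) (A : B →ₗ[ℂ] B) : Prop where
  schur_idempotent : schurProduct ψ A A = A
  star_preserving : ∀ b, A (star b) = star (A b)

end QuantumSets

/-! ### Quantum isomorphisms -/

section QuantumIso

variable {B₁ : Type*} [Ring B₁] [StarRing B₁] [Algebra ℂ B₁] [StarModule ℂ B₁]
variable {B₂ : Type*} [Ring B₂] [StarRing B₂] [Algebra ℂ B₂] [StarModule ℂ B₂]
variable {H : Type*} [NormedAddCommGroup H] [InnerProductSpace ℂ H] [CompleteSpace H]

/-- The inner product of `L²(B, ψ) ⊗ H`. -/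
def l2Form (H : Type*) [NormedAddCommGroup H] [InnerProductSpace ℂ H] (ψ : B₁ →ₗ[ℂ] ℂ) :
    (B₁ ⊗[ℂ] H) →ₗ⋆[ℂ] (B₁ ⊗[ℂ] H) →ₗ[ℂ] ℂ :=
  tensorForm (gnsForm ψ) (innerₛₗ ℂ)

/-- The map `x ↦ x (1 ⊗ ξ)` from `B₂ ⊗ B(H)` to `B₂ ⊗ H`, i.e. `b ⊗ T ↦ b ⊗ T ξ`. -/
def applyVec (B₂ : Type*) [Ring B₂] [Algebra ℂ B₂] (ξ : H) :
    (B₂ ⊗[ℂ] (H →L[ℂ] H)) →ₗ[ℂ] (B₂ ⊗[ℂ] H) :=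
  LinearMap.lTensor B₂ (ContinuousLinearMap.apply ℂ H ξ).toLinearMap

/-- The map `p : L²(B₁) ⊗ H → L²(B₂) ⊗ H`, `a ⊗ ξ ↦ ρ(a) (1 ⊗ ξ)`. -/
def isoMap (ρ : B₁ →⋆ₐ[ℂ] B₂ ⊗[ℂ] (H →L[ℂ] H)) : (B₁ ⊗[ℂ] H) →ₗ[ℂ] (B₂ ⊗[ℂ] H) :=
  TensorProduct.lift (LinearMap.mk₂ ℂ (fun a ξ => applyVec B₂ ξ (ρ a))
    (by intros; simp)
    (by intros; simp)
    (by
      intro a ξ η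
      simp only [applyVec, map_add, ContinuousLinearMap.toLinearMap_add, LinearMap.lTensor_add,
        LinearMap.add_apply])
    (by
      intro c a ξ
      simp only [applyVec, map_smul, ContinuousLinearMap.toLinearMap_smul, LinearMap.lTensor_smul,
        LinearMap.smul_apply]))

@[simp]
lemma isoMap_tmul (ρ : B₁ →⋆ₐ[ℂ] B₂ ⊗[ℂ] (H →L[ℂ] H)) (a : B₁) (ξ : H) :
    isoMap ρ (a ⊗ₜ[ℂ] ξ) = applyVec B₂ ξ (ρ a) := rfl

/-- The unital `⋆`-homomorphism `ρ : B₁ → B₂ ⊗ B(H)` is a quantum isomorphism from the quantum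
set `(B₁, ψ₁)` to the quantum set `(B₂, ψ₂)`: the map `p` is unitary. -/
structure IsQuantumSetIso (ψ₁ : B₁ →ₗ[ℂ] ℂ) (ψ₂ : B₂ →ₗ[ℂ] ℂ)
    (ρ : B₁ →⋆ₐ[ℂ] B₂ ⊗[ℂ] (H →L[ℂ] H)) : Prop where
  bijective : Function.Bijective (isoMap ρ)
  inner_map_map : ∀ x y : B₁ ⊗[ℂ] H,
    l2Form H ψ₂ (isoMap ρ x) (isoMap ρ y) = l2Form H ψ₁ x y

/-- `ρ` is a quantum isomorphism from the quantum graph `A₁` on `(B₁, ψ₁)` to the quantum graph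
`A₂` on `(B₂, ψ₂)`, i.e. in addition `ρ A₁ = (A₂ ⊗ id) ρ`. -/
structure IsQuantumGraphIso (ψ₁ : B₁ →ₗ[ℂ] ℂ) (A₁ : B₁ →ₗ[ℂ] B₁) (ψ₂ : B₂ →ₗ[ℂ] ℂ)
    (A₂ : B₂ →ₗ[ℂ] B₂) (ρ : B₁ →⋆ₐ[ℂ] B₂ ⊗[ℂ] (H →L[ℂ] H)) : Prop
    extends IsQuantumSetIso ψ₁ ψ₂ ρ where
  intertwines : ∀ a, ρ (A₁ a) = LinearMap.rTensor (H →L[ℂ] H) A₂ (ρ a)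

/-- The quantum graphs `A₁` on `(B₁, ψ₁)` and `A₂` on `(B₂, ψ₂)` are quantum isomorphic: there is
a quantum isomorphism over some nonzero finite dimensional Hilbert space. -/
def QuantumIsomorphic (ψ₁ : B₁ →ₗ[ℂ] ℂ) (A₁ : B₁ →ₗ[ℂ] B₁) (ψ₂ : B₂ →ₗ[ℂ] ℂ)
    (A₂ : B₂ →ₗ[ℂ] B₂) : Prop :=
  ∃ (H : Type u) (_ : NormedAddCommGroup H) (_ : InnerProductSpace ℂ H) (_ : CompleteSpace H)
    (_ : FiniteDimensional ℂ H) (_ : Nontrivial H) (ρ : B₁ →⋆ₐ[ℂ] B₂ ⊗[ℂ] (H →L[ℂ] H)),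
    IsQuantumGraphIso ψ₁ A₁ ψ₂ A₂ ρ

end QuantumIso

/-! ### Crossed products -/

section CrossedProduct

variable {Γ : Type*} [CommGroup Γ]
variable {B : Type*} [Ring B] [StarRing B] [Algebra ℂ B] [StarModule ℂ B]

/-- The crossed product `B ⋊_α Γ` of a finite group action. The family `f.coeff : Γ → B` stands
for `∑ χ, f.coeff χ u_χ`. -/
@[ext]
structure CrossedProduct (α : Γ →* (B ≃⋆ₐ[ℂ] B)) where
  coeff : Γ → B

namespace CrossedProduct

variable {α : Γ →* (B ≃⋆ₐ[ℂ] B)}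

variable (α) in
/-- An element of the crossed product is determined by its coefficients, which are arbitrary. -/
def coeffEquiv : CrossedProduct α ≃ (Γ → B) where
  toFun := coeff
  invFun := mk
  left_inv _ := rfl
  right_inv _ := rfl

instance : AddCommGroup (CrossedProduct α) := (coeffEquiv α).addCommGroup

instance : Module ℂ (CrossedProduct α) := (coeffEquiv α).module ℂ

@[simp] lemma zero_coeff (χ : Γ) : (0 : CrossedProduct α).coeff χ = 0 := rfl
@[simp] lemma add_coeff (f h : CrossedProduct α) (χ : Γ) :
    (f + h).coeff χ = f.coeff χ + h.coeff χ := rfl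
@[simp] lemma smul_coeff (c : ℂ) (f : CrossedProduct α) (χ : Γ) :
    (c • f).coeff χ = c • f.coeff χ := rfl

variable (α) in
/-- The element `b u_χ`. -/
def single [DecidableEq Γ] (b : B) (χ : Γ) : CrossedProduct α := ⟨fun ξ => if ξ = χ then b else 0⟩

@[simp]
lemma single_coeff [DecidableEq Γ] (b : B) (χ ξ : Γ) :
    (single α b χ).coeff ξ = if ξ = χ then b else 0 := rfl

variable (α) in
/-- The inclusion of `B` into the crossed product. -/
def ofBase [DecidableEq Γ] (b : B) : CrossedProduct α := single α b 1

variable (α) in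
/-- The canonical unitary `u_χ`. -/
def u [DecidableEq Γ] (χ : Γ) : CrossedProduct α := single α 1 χ

/-- `(b u_χ)⋆ = α_{χ⁻¹}(b⋆) u_{χ⁻¹}`, extended conjugate linearly. -/
instance : Star (CrossedProduct α) where
  star f := ⟨fun χ => α χ (star (f.coeff χ⁻¹))⟩

lemma star_coeff (f : CrossedProduct α) (χ : Γ) :
    (star f).coeff χ = α χ (star (f.coeff χ⁻¹)) := rfl

instance [DecidableEq Γ] : One (CrossedProduct α) := ⟨single α 1 1⟩

lemma one_coeff [DecidableEq Γ] (χ : Γ) :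
    (1 : CrossedProduct α).coeff χ = if χ = 1 then 1 else 0 := rfl

variable [Fintype Γ]

/-- `(b u_ξ) (c u_ζ) = b α_ξ(c) u_{ξζ}`, extended bilinearly. -/
instance : Mul (CrossedProduct α) where
  mul f h := ⟨fun χ => ∑ ξ, f.coeff ξ * α ξ (h.coeff (ξ⁻¹ * χ))⟩

lemma mul_coeff (f h : CrossedProduct α) (χ : Γ) :
    (f * h).coeff χ = ∑ ξ, f.coeff ξ * α ξ (h.coeff (ξ⁻¹ * χ)) := rfl

variable [DecidableEq Γ]

instance : Ring (CrossedProduct α) where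
  __ := (inferInstance : AddCommGroup (CrossedProduct α))
  left_distrib f h k := by
    ext χ; simp [mul_coeff, mul_add, Finset.sum_add_distrib]
  right_distrib f h k := by
    ext χ; simp [mul_coeff, add_mul, Finset.sum_add_distrib]
  zero_mul f := by ext χ; simp [mul_coeff]
  mul_zero f := by ext χ; simp [mul_coeff]
  one_mul f := by ext χ; simp [mul_coeff, one_coeff]
  mul_one f := by
    ext χ
    have (x : Γ) : x⁻¹ * χ = 1 ↔ x = χ := by rw [inv_mul_eq_one]
    simp [mul_coeff, one_coeff, this, apply_ite]
  mul_assoc f h k := by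
    ext χ
    simp only [mul_coeff, map_sum, map_mul, Finset.sum_mul, Finset.mul_sum]
    rw [Finset.sum_comm]
    refine Finset.sum_congr rfl fun ξ _ => ?_
    refine Fintype.sum_equiv (Equiv.mulLeft ξ⁻¹) _ _ fun ζ => ?_
    simp only [Equiv.coe_mulLeft, ← StarAlgEquiv.mul_apply, ← map_mul, mul_assoc]
    simp

instance : Algebra ℂ (CrossedProduct α) :=
  Algebra.ofModule
    (fun c f h => by ext χ; simp [mul_coeff, Finset.smul_sum])
    (fun c f h => by ext χ; simp [mul_coeff, Finset.smul_sum])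

instance : StarRing (CrossedProduct α) where
  star_involutive f := by
    ext χ
    simp only [star_coeff, map_inv, inv_inv, ← map_star, star_star, ← StarAlgEquiv.mul_apply]
    simp
  star_mul f h := by
    ext χ
    simp only [star_coeff, mul_coeff, star_sum, star_mul, map_sum, map_mul]
    refine Fintype.sum_equiv (Equiv.mulLeft χ) _ _ fun ξ => ?_
    simp only [Equiv.coe_mulLeft, ← map_star, ← StarAlgEquiv.mul_apply, ← map_mul, mul_inv_rev,
      inv_inv, inv_mul_cancel_right]
    congr 2
    simp
  star_add f h := by ext χ; simp [star_coeff]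

instance : StarModule ℂ (CrossedProduct α) where
  star_smul c f := by ext χ; simp [star_coeff]

end CrossedProduct

variable [Fintype Γ]

/-- The functional `ψ_⋊ (∑ b_χ u_χ) = n ψ(b_1)`, where `n = |Γ|`. -/
def crossedFunctional (α : Γ →* (B ≃⋆ₐ[ℂ] B)) (ψ : B →ₗ[ℂ] ℂ) : CrossedProduct α →ₗ[ℂ] ℂ where
  toFun f := (Fintype.card Γ : ℂ) * ψ (f.coeff 1)
  map_add' f h := by simp [mul_add]
  map_smul' c f := by simp [mul_left_comm]

/-- The map `E_⋊ (∑ b_χ u_χ) = n b_1`, where `n = |Γ|`. -/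
def condExp (α : Γ →* (B ≃⋆ₐ[ℂ] B)) : CrossedProduct α →ₗ[ℂ] B where
  toFun f := (Fintype.card Γ : ℂ) • f.coeff 1
  map_add' f h := by simp
  map_smul' c f := by simp [smul_comm c]

variable [DecidableEq Γ]

/-- The adjoint `E_⋊⋆` with respect to the inner products induced by `ψ_⋊` and `ψ`. -/
def condExpAdjoint (α : Γ →* (B ≃⋆ₐ[ℂ] B)) (ψ : B →ₗ[ℂ] ℂ) : B →ₗ[ℂ] CrossedProduct α :=
  formAdjoint (gnsForm (crossedFunctional α ψ)) (gnsForm ψ) (condExp α)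

end CrossedProduct

/-! ### Voltage quantum graphs and derived quantum graphs

`G` is a finite abelian group, written additively; its dual group `AddChar G ℂ` is written
multiplicatively. -/

section Derived

variable {G : Type*} [AddCommGroup G] [Fintype G]
variable {B : Type*} [Ring B] [StarRing B] [Algebra ℂ B] [StarModule ℂ B]

/-- `X_g b = (1/n) ∑ χ, conj (χ g) ⟨u_χ, b⟩ u_χ` on the crossed product. -/
def X (α : AddChar G ℂ →* (B ≃⋆ₐ[ℂ] B)) (ψ : B →ₗ[ℂ] ℂ) (g : G) :
    CrossedProduct α →ₗ[ℂ] CrossedProduct α :=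
  (Fintype.card G : ℂ)⁻¹ • ∑ χ : AddChar G ℂ, star (χ g) •
    (gnsForm (crossedFunctional α ψ) (CrossedProduct.u α χ)).smulRight (CrossedProduct.u α χ)

/-- `A = (A_g)` is a voltage quantum graph on `(B, ψ)` with respect to the action `α` of the dual
group of `G`. -/
structure IsVoltageQuantumGraph (α : AddChar G ℂ →* (B ≃⋆ₐ[ℂ] B)) (ψ : B →ₗ[ℂ] ℂ)
    (A : G → B →ₗ[ℂ] B) : Prop where
  isQuantumGraph : ∀ g, IsQuantumGraph ψ (A g)
  commutes : ∀ g χ b, A g (α χ b) = α χ (A g b)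

/-- The derived quantum graph `∑ g, m (X_g ⊗ E_⋊⋆ A_g E_⋊) m⋆` on the crossed product. -/
def derived (α : AddChar G ℂ →* (B ≃⋆ₐ[ℂ] B)) (ψ : B →ₗ[ℂ] ℂ) (A : G → B →ₗ[ℂ] B) :
    CrossedProduct α →ₗ[ℂ] CrossedProduct α :=
  ∑ g, schurProduct (crossedFunctional α ψ) (X α ψ g)
    (condExpAdjoint α ψ ∘ₗ A g ∘ₗ condExp α)

end Derived

/-! ### The tensor product quantum set `B ⊗ C(G)` and the Hilbert space `L²(G)` -/

section TensorSet

variable {G : Type*} [AddCommGroup G] [Fintype G]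
variable {B : Type*} [Ring B] [StarRing B] [Algebra ℂ B] [StarModule ℂ B]

/-- The functional `ψ ⊗ ψ_G` on `B ⊗ C(G)`, where `ψ_G f = ∑ g, f g`. -/
def tensorFunctional (G : Type*) [Fintype G] (ψ : B →ₗ[ℂ] ℂ) : B ⊗[ℂ] (G → ℂ) →ₗ[ℂ] ℂ :=
  LinearMap.mul' ℂ ℂ ∘ₗ TensorProduct.map ψ (∑ g : G, LinearMap.proj g)

/-- The `⋆`-isomorphism `B ⋊_triv Ĝ ≃ B ⊗ C(G)`, `∑ b_χ u_χ ↦ ∑ b_χ ⊗ χ`, for the trivial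
action. -/
def trivEquiv (G : Type*) [AddCommGroup G] [Fintype G]
    (B : Type*) [Ring B] [StarRing B] [Algebra ℂ B] [StarModule ℂ B] :
    CrossedProduct (1 : AddChar G ℂ →* (B ≃⋆ₐ[ℂ] B)) ≃⋆ₐ[ℂ] B ⊗[ℂ] (G → ℂ) where
  toFun f := ∑ χ : AddChar G ℂ, f.coeff χ ⊗ₜ[ℂ] (χ : G → ℂ)
  invFun x := ⟨TensorProduct.equivFinsuppOfBasisRight (M := B) (AddChar.complexBasis G) x⟩
  left_inv f := by
    ext χ
    have (ξ : AddChar G ℂ) : (AddChar.complexBasis G).repr (ξ : G → ℂ) = Finsupp.single ξ 1 := by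
      rw [← AddChar.complexBasis_apply, Module.Basis.repr_self]
    simp [this, Finsupp.single_apply]
  right_inv x := by
    conv_rhs => rw [← (TensorProduct.equivFinsuppOfBasisRight (M := B)
      (AddChar.complexBasis G)).symm_apply_apply x]
    rw [TensorProduct.equivFinsuppOfBasisRight_symm_apply, Finsupp.sum_fintype _ _ (by simp)]
    simp
  map_add' f h := by simp [TensorProduct.add_tmul, Finset.sum_add_distrib]
  map_smul' c f := by simp [TensorProduct.smul_tmul', Finset.smul_sum]
  map_mul' f h := by
    simp only [CrossedProduct.mul_coeff, TensorProduct.sum_tmul, Finset.sum_mul, Finset.mul_sum,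
      Algebra.TensorProduct.tmul_mul_tmul]
    rw [Finset.sum_comm, Finset.sum_comm (f := fun x y => (f.coeff y * h.coeff x) ⊗ₜ[ℂ] _)]
    refine Finset.sum_congr rfl fun ξ _ => ?_
    refine Fintype.sum_equiv (Equiv.mulLeft ξ⁻¹) _ _ fun ζ => ?_
    simp only [Equiv.coe_mulLeft, MonoidHom.one_apply, StarAlgEquiv.one_apply]
    congr 1
    rw [← AddChar.coe_mul, mul_inv_cancel_left]
  map_star' f := by
    simp only [star_sum, CrossedProduct.star_coeff, TensorProduct.star_tmul]
    refine Fintype.sum_equiv (Equiv.inv _) _ _ fun χ => ?_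
    simp only [Equiv.inv_apply, MonoidHom.one_apply, StarAlgEquiv.one_apply]
    congr 1
    funext g
    simp [AddChar.inv_apply, ← AddChar.map_neg_eq_conj]

/-- The derived quantum graph for the trivial action, carried over to `B ⊗ C(G)`. -/
def derivedTensor (ψ : B →ₗ[ℂ] ℂ) (A : G → B →ₗ[ℂ] B) :
    B ⊗[ℂ] (G → ℂ) →ₗ[ℂ] B ⊗[ℂ] (G → ℂ) :=
  (trivEquiv G B).toAlgEquiv.toLinearMap ∘ₗ derived 1 ψ A ∘ₗ
    (trivEquiv G B).symm.toAlgEquiv.toLinearMap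

/-- The Hilbert space `L²(G)`, with `⟨f, h⟩ = ∑ g, conj (f g) h g`. -/
abbrev L2 (G : Type*) [Fintype G] : Type _ := EuclideanSpace ℂ G

/-- The character `χ` as a vector `e_χ` of `L²(G)`; these vectors form an orthogonal basis, with
`⟨e_χ, e_χ⟩ = n`. -/
def charVec (χ : AddChar G ℂ) : L2 G := WithLp.toLp 2 (χ : G → ℂ)

/-- The matrix unit `E_{ξ,ζ}` for the basis `(e_χ)`: it maps `e_ζ` to `e_ξ` and the other basis
vectors to `0`. -/
def matrixUnit (ξ ζ : AddChar G ℂ) : L2 G →L[ℂ] L2 G :=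
  (Fintype.card G : ℂ)⁻¹ • InnerProductSpace.rankOne ℂ (charVec ξ) (charVec ζ)

end TensorSet

end

end QGraph

namespace QGraph

/-! ### Adjoints -/

section Adjoints

variable {V : Type*} [AddCommGroup V] [Module ℂ V] {W : Type*} [AddCommGroup W] [Module ℂ W]

/-! The proof is Fourier analysis along the dual group. Since `ψ` is invariant, the crossed product
is the orthogonal sum of the subspaces `B u_χ`, each a copy of `B` with its form scaled by `n`
(`gnsForm_crossedFunctional`). This gives `m⋆(b u_χ) = n⁻¹ ∑ ξ, b₍₁₎ u_ξ ⊗ u_ξ⋆ b₍₂₎ u_χ`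
(`comul_crossedFunctional`), whence `m m⋆ = id`.

With this formula the derived graph becomes diagonal: it sends `b u_χ` to `(∑ g, conj (χ g) A_g b)
u_χ` (`derived_single`). The action no longer appears, so the derived graphs of two actions agree on
coefficients; only the products of the two algebras differ. Schur idempotence reduces to that of
each `A_g` through orthogonality of characters (`sum_schurProduct_fourierComponent`).

Matrices over `L²(G)` absorb the difference of the products. For actions `α`, `β` and an auxiliary
`γ` with `β_χ γ_{χ⁻¹ζ} = γ_ζ α_χ`, the map `b u_χ ↦ ∑ ζ, γ_ζ(b) u_χ ⊗ E_{ζ, χ⁻¹ζ}` is a unital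
`⋆`-homomorphism (`twistHom`). Its map on `L²` is the shear `b u_χ ⊗ e_η ↦ γ_{χη}(b) u_χ ⊗ e_{χη}`,
which is visibly unitary, and it intertwines the derived graphs because every `A_g` commutes with
`γ`. The choice `(1, α, α)` for `(α, β, γ)` gives `ρ`; the choice `(α, 1, α ∘ inv)` gives the
quantum isomorphism in the opposite direction. -/

lemma tensorProduct_eq_zero_of_forall_dual [FiniteDimensional ℂ V] [FiniteDimensional ℂ W]
    (x : V ⊗[ℂ] W)
    (h : ∀ (f : V →ₗ[ℂ] ℂ) (g : W →ₗ[ℂ] ℂ),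
      LinearMap.mul' ℂ ℂ (TensorProduct.map f g x) = 0) : x = 0 := by
  let b := Module.finBasis ℂ V
  let c := Module.finBasis ℂ W
  -- Coordinates in a product basis are tensor products of coordinate functionals, so the hypothesis
  -- kills them all.
  have key (i j) : (b.tensorProduct c).repr x (i, j) =
      LinearMap.mul' ℂ ℂ (TensorProduct.map (b.coord i) (c.coord j) x) := by
    clear h
    induction x with
    | zero => simp
    | tmul v w => simp [mul_comm]
    | add y z hy hz => simp_all
  apply (b.tensorProduct c).repr.injective
  ext ⟨i, j⟩
  rw [key, h]
  simp

/-- Nondegeneracy of `s` makes adjoints unique, so the chosen adjoint is whichever one can be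
exhibited. All explicit formulas for `m⋆` and `E_⋊⋆` come through here. -/
lemma formAdjoint_eq {s : V →ₗ⋆[ℂ] V →ₗ[ℂ] ℂ} {t : W →ₗ⋆[ℂ] W →ₗ[ℂ] ℂ}
    {T : V →ₗ[ℂ] W} {S : W →ₗ[ℂ] V} (hs : ∀ x, (∀ a, s a x = 0) → x = 0)
    (h : IsAdjoint s t T S) : formAdjoint s t T = S := by
  have hex : ∃ S, IsAdjoint s t T S := ⟨S, h⟩
  rw [formAdjoint, dif_pos hex]
  ext b
  rw [← sub_eq_zero]
  refine hs _ fun a => ?_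
  rw [map_sub, ← hex.choose_spec a b, ← h a b, sub_self]

end Adjoints

/-! ### Nondegeneracy of the forms and the counit identity. -/

section QuantumSets

variable {B : Type*} [Ring B] [StarRing B] [Algebra ℂ B] [StarModule ℂ B]

lemma IsFaithfulPositive.eq_zero {ψ : B →ₗ[ℂ] ℂ} (hψ : IsFaithfulPositive ψ) (x : B)
    (h : ∀ a, gnsForm ψ a x = 0) : x = 0 :=
  hψ.faithful x (h x)

/-- Riesz representation: `a ↦ ψ(a ·)` is injective by faithfulness, hence onto the dual by
dimension. The star is left out of `L` to keep it linear and is restored in the witness. -/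
lemma IsFaithfulPositive.exists_mul_left [FiniteDimensional ℂ B] {ψ : B →ₗ[ℂ] ℂ}
    (hψ : IsFaithfulPositive ψ) (f : B →ₗ[ℂ] ℂ) : ∃ a, gnsForm ψ a = f := by
  let L : B →ₗ[ℂ] Module.Dual ℂ B := (LinearMap.mul ℂ B).compr₂ ψ
  have hL : Function.Injective L := by
    rw [← LinearMap.ker_eq_bot, LinearMap.ker_eq_bot']
    intro a ha
    have h := hψ.faithful (star a) (by simpa [L] using LinearMap.congr_fun ha (star a))
    simpa using h
  obtain ⟨a, ha⟩ := (LinearMap.injective_iff_surjective_of_finrank_eq_finrank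
    (Subspace.dual_finrank_eq (K := ℂ) (V := B)).symm).1 hL f
  refine ⟨star a, ?_⟩
  rw [← ha]
  ext b
  simp [L]

/-- Pairing with pure tensors already realizes every `f ⊗ g`, so positivity of `ψ ⊗ ψ` is not
needed. -/
lemma IsFaithfulPositive.tensor_eq_zero [FiniteDimensional ℂ B] {ψ : B →ₗ[ℂ] ℂ}
    (hψ : IsFaithfulPositive ψ) (x : B ⊗[ℂ] B)
    (h : ∀ a, tensorForm (gnsForm ψ) (gnsForm ψ) a x = 0) : x = 0 := by
  refine tensorProduct_eq_zero_of_forall_dual x fun f g => ?_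
  obtain ⟨a, rfl⟩ := hψ.exists_mul_left f
  obtain ⟨b, rfl⟩ := hψ.exists_mul_left g
  exact h (a ⊗ₜ b)

lemma comul_eq [FiniteDimensional ℂ B] {ψ : B →ₗ[ℂ] ℂ} (hψ : IsFaithfulPositive ψ)
    {S : B →ₗ[ℂ] B ⊗[ℂ] B}
    (h : IsAdjoint (tensorForm (gnsForm ψ) (gnsForm ψ)) (gnsForm ψ) (LinearMap.mul' ℂ B) S) :
    comul ψ = S :=
  formAdjoint_eq hψ.tensor_eq_zero h

lemma IsQuantumSet.isAdjoint_comul {ψ : B →ₗ[ℂ] ℂ} (hψ : IsQuantumSet ψ) :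
    IsAdjoint (tensorForm (gnsForm ψ) (gnsForm ψ)) (gnsForm ψ) (LinearMap.mul' ℂ B)
      (comul ψ) := by
  by_cases h : ∃ S, IsAdjoint (tensorForm (gnsForm ψ) (gnsForm ψ)) (gnsForm ψ)
      (LinearMap.mul' ℂ B) S
  · rw [comul, formAdjoint, dif_pos h]
    exact h.choose_spec
  -- Without an adjoint, `comul ψ` takes the default value `0`; then `m m⋆ = id` forces `B = 0`,
  -- where adjointness is trivial.
  · have h0 : comul ψ = 0 := by rw [comul, formAdjoint, dif_neg h]
    have h1 := hψ.mul_comul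
    intro a b
    have hb : b = 0 := by simpa [h0] using (LinearMap.congr_fun h1 b).symm
    simp [hb]

lemma IsQuantumSet.tensorForm_comul {ψ : B →ₗ[ℂ] ℂ} (hψ : IsQuantumSet ψ) (a b c : B) :
    tensorForm (gnsForm ψ) (gnsForm ψ) (a ⊗ₜ b) (comul ψ c) = gnsForm ψ (a * b) c :=
  (hψ.isAdjoint_comul (a ⊗ₜ b) c).symm

/-- Adjoint form of `1 * b = b`: pairing `m⋆ c` with `1 ⊗ b` applies `ψ` to the first leg. -/
lemma IsQuantumSet.counit_comul {ψ : B →ₗ[ℂ] ℂ} (hψ : IsQuantumSet ψ) (c : B) :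
    TensorProduct.lid ℂ B (LinearMap.rTensor B ψ (comul ψ c)) = c := by
  rw [← sub_eq_zero]
  refine hψ.faithfulPositive.eq_zero _ fun b => ?_
  have h := hψ.tensorForm_comul 1 b c
  rw [one_mul] at h
  rw [map_sub, sub_eq_zero, ← h]
  clear h
  induction comul ψ c with
  | zero => simp
  | tmul x y => simp
  | add y z hy hz => simp_all [mul_add]

/-! ### Transport along `⋆`-isomorphisms preserving the functionals. -/

section Transport

variable {C : Type*} [Ring C] [StarRing C] [Algebra ℂ C] [StarModule ℂ C]

lemma gnsForm_map_starAlgEquiv {ψ : B →ₗ[ℂ] ℂ} {φ : C →ₗ[ℂ] ℂ} (e : B ≃⋆ₐ[ℂ] C)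
    (he : ∀ b, φ (e b) = ψ b) (a b : B) : gnsForm φ (e a) (e b) = gnsForm ψ a b := by
  simp [← map_star, ← map_mul, he]

lemma IsFaithfulPositive.of_starAlgEquiv {ψ : B →ₗ[ℂ] ℂ} {φ : C →ₗ[ℂ] ℂ}
    (hψ : IsFaithfulPositive ψ) (e : B ≃⋆ₐ[ℂ] C) (he : ∀ b, φ (e b) = ψ b) :
    IsFaithfulPositive φ where
  nonneg a := by
    obtain ⟨a, rfl⟩ := EquivLike.surjective e a
    have := gnsForm_map_starAlgEquiv e he a a
    simp only [gnsForm_apply] at this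
    rw [this]
    exact hψ.nonneg a
  faithful a h := by
    obtain ⟨a, rfl⟩ := EquivLike.surjective e a
    have := gnsForm_map_starAlgEquiv e he a a
    simp only [gnsForm_apply] at this
    rw [hψ.faithful a (this ▸ h), map_zero]

lemma finiteDimensional_of_starAlgEquiv [FiniteDimensional ℂ B] (e : B ≃⋆ₐ[ℂ] C) :
    FiniteDimensional ℂ C :=
  LinearEquiv.finiteDimensional e.toAlgEquiv.toLinearEquiv

lemma comul_of_starAlgEquiv {ψ : B →ₗ[ℂ] ℂ} {φ : C →ₗ[ℂ] ℂ}
    (hψ : IsQuantumSet ψ) (e : B ≃⋆ₐ[ℂ] C) (he : ∀ b, φ (e b) = ψ b) :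
    comul φ = TensorProduct.map e.toAlgEquiv.toLinearMap e.toAlgEquiv.toLinearMap ∘ₗ comul ψ ∘ₗ
      e.symm.toAlgEquiv.toLinearMap := by
  have := hψ.finiteDimensional
  have := finiteDimensional_of_starAlgEquiv e
  refine comul_eq (hψ.faithfulPositive.of_starAlgEquiv e he) fun x c => ?_
  induction x with
  | zero => simp
  | add x y hx hy => rw [map_add, map_add, map_add, LinearMap.add_apply, LinearMap.add_apply, hx, hy]
  | tmul a b =>
    obtain ⟨a, rfl⟩ := EquivLike.surjective e a
    obtain ⟨b, rfl⟩ := EquivLike.surjective e b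
    obtain ⟨c, rfl⟩ := EquivLike.surjective e c
    rw [LinearMap.mul'_apply, ← map_mul, gnsForm_map_starAlgEquiv e he, ← hψ.tensorForm_comul]
    have hc : e.symm.toAlgEquiv.toLinearMap (e c) = c := e.symm_apply_apply c
    rw [LinearMap.comp_apply, LinearMap.comp_apply, hc]
    induction comul ψ c with
    | zero => simp
    | add x y hx hy => simp only [map_add, hx, hy]
    | tmul x y =>
      have h := gnsForm_map_starAlgEquiv e he
      rw [TensorProduct.map_tmul, tensorForm_tmul, tensorForm_tmul, ← h, ← h b]
      rfl

lemma schurProduct_of_starAlgEquiv {ψ : B →ₗ[ℂ] ℂ} {φ : C →ₗ[ℂ] ℂ}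
    (hψ : IsQuantumSet ψ) (e : B ≃⋆ₐ[ℂ] C) (he : ∀ b, φ (e b) = ψ b) (S T : B →ₗ[ℂ] B) :
    schurProduct φ
      (e.toAlgEquiv.toLinearMap ∘ₗ S ∘ₗ e.symm.toAlgEquiv.toLinearMap)
      (e.toAlgEquiv.toLinearMap ∘ₗ T ∘ₗ e.symm.toAlgEquiv.toLinearMap) =
      e.toAlgEquiv.toLinearMap ∘ₗ schurProduct ψ S T ∘ₗ e.symm.toAlgEquiv.toLinearMap := by
  rw [schurProduct, comul_of_starAlgEquiv hψ e he]
  ext c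
  simp only [schurProduct, LinearMap.comp_apply]
  induction comul ψ (e.symm.toAlgEquiv.toLinearMap c) with
  | zero => simp
  | add x y hx hy => simp only [map_add, hx, hy]
  | tmul x y => simp

lemma IsQuantumSet.of_starAlgEquiv {ψ : B →ₗ[ℂ] ℂ} {φ : C →ₗ[ℂ] ℂ}
    (hψ : IsQuantumSet ψ) (e : B ≃⋆ₐ[ℂ] C) (he : ∀ b, φ (e b) = ψ b) : IsQuantumSet φ where
  finiteDimensional :=
    have := hψ.finiteDimensional
    finiteDimensional_of_starAlgEquiv e
  faithfulPositive := hψ.faithfulPositive.of_starAlgEquiv e he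
  mul_comul := by
    -- The condition `m m⋆ = id` is the Schur product of the identity with itself.
    have h := schurProduct_of_starAlgEquiv hψ e he .id .id
    have h1 : e.toAlgEquiv.toLinearMap ∘ₗ e.symm.toAlgEquiv.toLinearMap = .id := by
      ext; simp
    simpa [schurProduct, hψ.mul_comul, h1] using h

lemma IsQuantumGraph.of_starAlgEquiv {ψ : B →ₗ[ℂ] ℂ} {φ : C →ₗ[ℂ] ℂ}
    (hψ : IsQuantumSet ψ) {A : B →ₗ[ℂ] B} (hA : IsQuantumGraph ψ A) (e : B ≃⋆ₐ[ℂ] C)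
    (he : ∀ b, φ (e b) = ψ b) :
    IsQuantumGraph φ (e.toAlgEquiv.toLinearMap ∘ₗ A ∘ₗ e.symm.toAlgEquiv.toLinearMap) where
  schur_idempotent := by rw [schurProduct_of_starAlgEquiv hψ e he, hA.schur_idempotent]
  star_preserving c := by
    simp [map_star, hA.star_preserving]

end Transport

end QuantumSets

/-! ### Crossed products as quantum sets -/

namespace CrossedProduct

variable {Γ : Type*} [CommGroup Γ] [DecidableEq Γ]
variable {B : Type*} [Ring B] [StarRing B] [Algebra ℂ B] [StarModule ℂ B]
variable (α : Γ →* (B ≃⋆ₐ[ℂ] B))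

/-- `b ↦ b u_χ` as a linear map. -/
def singleLinear (χ : Γ) : B →ₗ[ℂ] CrossedProduct α where
  toFun b := single α b χ
  map_add' a b := by ext; simp only [single_coeff, add_coeff]; split_ifs <;> simp
  map_smul' c b := by ext; simp

@[simp]
lemma singleLinear_apply (χ : Γ) (b : B) : singleLinear α χ b = single α b χ := rfl

/-- The coefficient of `u_χ` as a linear map. -/
def coeffLinear (χ : Γ) : CrossedProduct α →ₗ[ℂ] B where
  toFun f := f.coeff χ
  map_add' _ _ := rfl
  map_smul' _ _ := rfl

@[simp]
lemma coeffLinear_apply (χ : Γ) (f : CrossedProduct α) : coeffLinear α χ f = f.coeff χ := rfl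

/-- An action does not matter for the linear structure of the crossed product. -/
def coeffLinearEquiv : CrossedProduct α ≃ₗ[ℂ] (Γ → B) where
  __ := coeffEquiv α
  map_add' _ _ := rfl
  map_smul' _ _ := rfl

variable {α}

@[simp]
lemma sum_coeff {ι : Type*} (s : Finset ι) (f : ι → CrossedProduct α) (χ : Γ) :
    (∑ i ∈ s, f i).coeff χ = ∑ i ∈ s, (f i).coeff χ :=
  map_sum (coeffLinear α χ) f s

variable [Fintype Γ]

lemma sum_single (f : CrossedProduct α) : ∑ χ, single α (f.coeff χ) χ = f := by
  ext χ
  simp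

lemma linearMap_ext {V : Type*} [AddCommGroup V] [Module ℂ V] {S T : CrossedProduct α →ₗ[ℂ] V}
    (h : ∀ b χ, S (single α b χ) = T (single α b χ)) : S = T := by
  ext f
  rw [← sum_single f]
  simp [h]

lemma single_mul_single (b c : B) (ξ ζ : Γ) :
    single α b ξ * single α c ζ = single α (b * α ξ c) (ξ * ζ) := by
  ext χ
  simp only [mul_coeff, single_coeff, ite_mul, zero_mul, Finset.sum_ite_eq', Finset.mem_univ,
    if_true, inv_mul_eq_iff_eq_mul]
  split_ifs <;> simp

lemma star_single (b : B) (χ : Γ) :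
    star (single α b χ) = single α (α χ⁻¹ (star b)) χ⁻¹ := by
  ext ξ
  simp only [star_coeff, single_coeff, inv_eq_iff_eq_inv]
  split_ifs with h <;> simp [h]

lemma one_eq_single : (1 : CrossedProduct α) = single α 1 1 := rfl

variable (α) in
/-- `u_ζ b u_ζ⋆ u_χ = α_ζ(b) u_χ`. -/
lemma u_mul_ofBase_mul_star_mul_u (b : B) (ζ χ : Γ) :
    u α ζ * ofBase α b * star (u α ζ) * u α χ = single α (α ζ b) χ := by
  simp [u, ofBase, single_mul_single, star_single]

end CrossedProduct

namespace CrossedProduct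

variable {Γ : Type*} [CommGroup Γ] [DecidableEq Γ] [Fintype Γ]
variable {B : Type*} [Ring B] [StarRing B] [Algebra ℂ B] [StarModule ℂ B]
variable {α : Γ →* (B ≃⋆ₐ[ℂ] B)} {ψ : B →ₗ[ℂ] ℂ}

instance : SMulCommClass ℂ (CrossedProduct α) (CrossedProduct α) := Algebra.to_smulCommClass

instance : IsScalarTower ℂ (CrossedProduct α) (CrossedProduct α) := IsScalarTower.right

@[simp]
lemma action_apply_inv_apply (χ : Γ) (b : B) : α χ (α χ⁻¹ b) = b := by
  rw [← StarAlgEquiv.mul_apply, ← map_mul]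
  simp

@[simp]
lemma single_zero (χ : Γ) : single α 0 χ = 0 := map_zero (singleLinear α χ)

lemma single_smul (c : ℂ) (b : B) (χ : Γ) : single α (c • b) χ = c • single α b χ :=
  map_smul (singleLinear α χ) c b

lemma single_sum {ι : Type*} (s : Finset ι) (f : ι → B) (χ : Γ) :
    single α (∑ i ∈ s, f i) χ = ∑ i ∈ s, single α (f i) χ :=
  map_sum (singleLinear α χ) f s

/-- The coefficient of `f⋆ h` at `1` is a sum of terms `α_χ(f_{χ⁻¹}⋆ h_{χ⁻¹})`, and invariance of
`ψ` removes `α_χ`. Thus the components `B u_χ` are mutually orthogonal. -/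
lemma gnsForm_crossedFunctional (hα : ∀ χ b, ψ (α χ b) = ψ b) (f h : CrossedProduct α) :
    gnsForm (crossedFunctional α ψ) f h =
      (Fintype.card Γ : ℂ) * ∑ χ, gnsForm ψ (f.coeff χ) (h.coeff χ) := by
  simp only [gnsForm_apply, crossedFunctional, LinearMap.coe_mk, AddHom.coe_mk, mul_coeff,
    star_coeff, map_sum, mul_one, ← map_mul, hα]
  congr 1
  exact Fintype.sum_equiv (Equiv.inv Γ) _ _ fun χ => rfl

lemma gnsForm_single_right (hα : ∀ χ b, ψ (α χ b) = ψ b) (f : CrossedProduct α) (b : B) (χ : Γ) :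
    gnsForm (crossedFunctional α ψ) f (single α b χ) =
      (Fintype.card Γ : ℂ) * gnsForm ψ (f.coeff χ) b := by
  rw [gnsForm_crossedFunctional hα, Finset.sum_eq_single χ] <;> simp +contextual

lemma isFaithfulPositive (hα : ∀ χ b, ψ (α χ b) = ψ b) (hψ : IsFaithfulPositive ψ) :
    IsFaithfulPositive (crossedFunctional α ψ) where
  nonneg f := by
    rw [← gnsForm_apply, gnsForm_crossedFunctional hα]
    exact mul_nonneg (Nat.cast_nonneg _) (Finset.sum_nonneg fun χ _ => hψ.nonneg _)
  faithful f h := by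
    rw [← gnsForm_apply, gnsForm_crossedFunctional hα, mul_eq_zero] at h
    have h0 := (Finset.sum_eq_zero_iff_of_nonneg fun χ _ => hψ.nonneg (f.coeff χ)).1
      (h.resolve_left (by simp))
    ext χ
    exact hψ.faithful _ (h0 χ (Finset.mem_univ _))

instance finiteDimensional [FiniteDimensional ℂ B] : FiniteDimensional ℂ (CrossedProduct α) :=
  LinearEquiv.finiteDimensional (coeffLinearEquiv α).symm

/-- Moving `u_ξ` past the second leg undoes the twist by `α_{ξ⁻¹}`. These twisted tensors are the
summands of `m⋆`. -/
lemma mul'_map_single (ξ ζ : Γ) (y : B ⊗[ℂ] B) :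
    LinearMap.mul' ℂ (CrossedProduct α) (TensorProduct.map (singleLinear α ξ)
      (singleLinear α ζ ∘ₗ (α ξ⁻¹).toAlgEquiv.toLinearMap) y) =
      single α (LinearMap.mul' ℂ B y) (ξ * ζ) := by
  rw [← singleLinear_apply]
  induction y with
  | zero => simp
  | add y z hy hz => simp only [map_add, hy, hz]
  | tmul b c =>
    have hc : (α ξ⁻¹).toAlgEquiv.toLinearMap c = α ξ⁻¹ c := rfl
    simp only [TensorProduct.map_tmul, LinearMap.comp_apply, singleLinear_apply,
      LinearMap.mul'_apply, single_mul_single, hc, action_apply_inv_apply]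

/-- Invariance of `ψ` moves the twist onto the other argument; each leg contributes one factor `n`.
-/
lemma tensorForm_map_single (hα : ∀ χ b, ψ (α χ b) = ψ b) (f h : CrossedProduct α) (ξ ζ : Γ)
    (y : B ⊗[ℂ] B) :
    tensorForm (gnsForm (crossedFunctional α ψ)) (gnsForm (crossedFunctional α ψ)) (f ⊗ₜ h)
      (TensorProduct.map (singleLinear α ξ)
        (singleLinear α ζ ∘ₗ (α ξ⁻¹).toAlgEquiv.toLinearMap) y) =
      (Fintype.card Γ : ℂ) * (Fintype.card Γ : ℂ) *
        tensorForm (gnsForm ψ) (gnsForm ψ) (f.coeff ξ ⊗ₜ α ξ (h.coeff ζ)) y := by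
  induction y with
  | zero => simp
  | add y z hy hz => simp only [map_add, hy, hz, mul_add]
  | tmul b c =>
    have hc : gnsForm ψ (α ξ (h.coeff ζ)) c = gnsForm ψ (h.coeff ζ) (α ξ⁻¹ c) := by
      rw [gnsForm_apply, gnsForm_apply, ← hα ξ (star (h.coeff ζ) * _), map_mul (α ξ),
        map_star (α ξ), action_apply_inv_apply]
    rw [TensorProduct.map_tmul, tensorForm_tmul, tensorForm_tmul, hc, singleLinear_apply,
      LinearMap.comp_apply, singleLinear_apply, gnsForm_single_right hα, gnsForm_single_right hα,
      mul_mul_mul_comm]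
    rfl

variable (α ψ) in
/-- The comultiplication of the crossed product,
`b u_χ ↦ n⁻¹ ∑ ξ, b₍₁₎ u_ξ ⊗ u_ξ⋆ b₍₂₎ u_χ`. -/
noncomputable def crossedComul : CrossedProduct α →ₗ[ℂ] CrossedProduct α ⊗[ℂ] CrossedProduct α :=
  (Fintype.card Γ : ℂ)⁻¹ • ∑ χ, ∑ ξ, TensorProduct.map (singleLinear α ξ)
    (singleLinear α (ξ⁻¹ * χ) ∘ₗ (α ξ⁻¹).toAlgEquiv.toLinearMap) ∘ₗ comul ψ ∘ₗ coeffLinear α χ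

/-- Pairing with `f ⊗ h` assembles the terms `f_ξ α_ξ(h_{ξ⁻¹χ})` into the coefficients of `f h`. The
factor `n⁻¹` reconciles the `n²` of the tensor form with the `n` of `ψ_⋊`. -/
lemma comul_crossedFunctional (hα : ∀ χ b, ψ (α χ b) = ψ b) (hψ : IsQuantumSet ψ) :
    comul (crossedFunctional α ψ) = crossedComul α ψ := by
  have := hψ.finiteDimensional
  refine comul_eq (isFaithfulPositive hα hψ.faithfulPositive) fun x k => ?_
  induction x with
  | zero => simp
  | add x y hx hy => simp only [map_add, LinearMap.add_apply, hx, hy]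
  | tmul f h =>
    simp only [crossedComul, LinearMap.smul_apply, LinearMap.sum_apply, LinearMap.comp_apply,
      map_smul, map_sum, coeffLinear_apply, tensorForm_map_single hα, hψ.tensorForm_comul]
    rw [LinearMap.mul'_apply, gnsForm_crossedFunctional hα]
    simp only [mul_coeff, map_sum, LinearMap.sum_apply, ← Finset.mul_sum, smul_eq_mul]
    rw [← mul_assoc, ← mul_assoc, inv_mul_cancel₀ (by simp), one_mul]

lemma comul_single (hα : ∀ χ b, ψ (α χ b) = ψ b) (hψ : IsQuantumSet ψ) (b : B) (χ : Γ) :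
    comul (crossedFunctional α ψ) (single α b χ) =
      (Fintype.card Γ : ℂ)⁻¹ • ∑ ξ, TensorProduct.map (singleLinear α ξ)
        (singleLinear α (ξ⁻¹ * χ) ∘ₗ (α ξ⁻¹).toAlgEquiv.toLinearMap) (comul ψ b) := by
  simp only [comul_crossedFunctional hα hψ, crossedComul, LinearMap.smul_apply,
    LinearMap.sum_apply, LinearMap.comp_apply, coeffLinear_apply, single_coeff]
  rw [Finset.sum_eq_single χ] <;> simp +contextual

lemma isQuantumSet (hα : ∀ χ b, ψ (α χ b) = ψ b) (hψ : IsQuantumSet ψ) :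
    IsQuantumSet (crossedFunctional α ψ) where
  finiteDimensional :=
    have := hψ.finiteDimensional
    inferInstance
  faithfulPositive := isFaithfulPositive hα hψ.faithfulPositive
  mul_comul := by
    refine linearMap_ext fun b χ => ?_
    have h : LinearMap.mul' ℂ B (comul ψ b) = b := LinearMap.congr_fun hψ.mul_comul b
    rw [LinearMap.comp_apply, comul_single hα hψ]
    -- Each of the `n` summands multiplies back to `b u_χ`, so the prefactor `n⁻¹` is exactly
    -- compensated.
    simp only [map_smul, map_sum, mul'_map_single, mul_inv_cancel_left, h]
    simp [← Nat.cast_smul_eq_nsmul ℂ, smul_smul]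

lemma condExp_apply (f : CrossedProduct α) :
    condExp α f = (Fintype.card Γ : ℂ) • f.coeff 1 := rfl

/-- The `n` in `E_⋊` matches the `n` in `ψ_⋊`, so the adjoint is the inclusion with no scalar. -/
lemma condExpAdjoint_eq (hα : ∀ χ b, ψ (α χ b) = ψ b) (hψ : IsFaithfulPositive ψ) :
    condExpAdjoint α ψ = singleLinear α 1 := by
  refine formAdjoint_eq (isFaithfulPositive hα hψ).eq_zero fun f b => ?_
  rw [singleLinear_apply, gnsForm_single_right hα]
  simp [condExp_apply]

lemma condExp_single (b : B) (χ : Γ) :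
    condExp α (single α b χ) = if χ = 1 then (Fintype.card Γ : ℂ) • b else 0 := by
  simp [condExp_apply, eq_comm]

end CrossedProduct

/-! ### Derived quantum graphs -/

section Derived

open CrossedProduct

variable {G : Type*} [AddCommGroup G] [Fintype G]
variable {B : Type*} [Ring B] [StarRing B] [Algebra ℂ B] [StarModule ℂ B]
variable {α : AddChar G ℂ →* (B ≃⋆ₐ[ℂ] B)} {ψ : B →ₗ[ℂ] ℂ}

lemma X_single (hα : ∀ χ b, ψ (α χ b) = ψ b) (g : G) (b : B) (χ : AddChar G ℂ) :
    X α ψ g (single α b χ) = (star (χ g) * ψ b) • u α χ := by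
  have h (ξ : AddChar G ℂ) : gnsForm (crossedFunctional α ψ) (u α ξ) (single α b χ) =
      if χ = ξ then (Fintype.card G : ℂ) * ψ b else 0 := by
    rw [gnsForm_single_right hα, u, single_coeff, AddChar.card_eq]
    split_ifs <;> simp
  simp only [X, LinearMap.smul_apply, LinearMap.sum_apply, LinearMap.smulRight_apply, h]
  rw [Finset.sum_eq_single χ]
  · simp only [if_true, smul_smul]
    congr 1
    field_simp
  · intro ξ _ hξ
    simp [hξ.symm]
  · simp

/-- The `χ`-component `∑ g, conj (χ g) A_g` of the derived quantum graph. -/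
noncomputable def fourierComponent (A : G → B →ₗ[ℂ] B) (χ : AddChar G ℂ) : B →ₗ[ℂ] B :=
  ∑ g, star (χ g) • A g

/-- In `m⋆(b u_χ)` the second leg lies in `B u_{ξ⁻¹χ}`, so `E_⋊` keeps only `ξ = χ`. On the first
leg `X_g` applies `ψ`, and the counit identity collapses `m⋆ b` to `b`. Since `T` commutes with `α`,
the remaining twist `α_{χ⁻¹}` cancels against `u_χ`. -/
lemma schurProduct_X_single (hα : ∀ χ b, ψ (α χ b) = ψ b) (hψ : IsQuantumSet ψ) (g : G)
    {T : B →ₗ[ℂ] B} (hT : ∀ χ b, T (α χ b) = α χ (T b)) (b : B) (χ : AddChar G ℂ) :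
    schurProduct (crossedFunctional α ψ) (X α ψ g) (condExpAdjoint α ψ ∘ₗ T ∘ₗ condExp α)
      (single α b χ) = single α (star (χ g) • T b) χ := by
  have key (ξ ζ : AddChar G ℂ) (y : B ⊗[ℂ] B) :
      LinearMap.mul' ℂ (CrossedProduct α) (TensorProduct.map (X α ψ g) (condExpAdjoint α ψ ∘ₗ T ∘ₗ condExp α)
        (TensorProduct.map (singleLinear α ξ)
          (singleLinear α ζ ∘ₗ (α ξ⁻¹).toAlgEquiv.toLinearMap) y)) =
      (if ζ = 1 then (Fintype.card G : ℂ) * star (ξ g) else 0) •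
        singleLinear α ξ (T (TensorProduct.lid ℂ B (LinearMap.rTensor B ψ y))) := by
    induction y with
    | zero => simp
    | add y z hy hz => simp only [map_add, hy, hz, smul_add]
    | tmul a c =>
      have hs (x : B) : u α ξ * single α (α ξ⁻¹ x) 1 = single α x ξ := by
        rw [u, single_mul_single, action_apply_inv_apply, one_mul, mul_one]
      have hc : (α ξ⁻¹).toAlgEquiv.toLinearMap c = α ξ⁻¹ c := rfl
      simp only [TensorProduct.map_tmul, LinearMap.comp_apply, singleLinear_apply,
        X_single hα, condExpAdjoint_eq hα hψ.faithfulPositive, condExp_single,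
        LinearMap.mul'_apply, AddChar.card_eq, LinearMap.rTensor_tmul, TensorProduct.lid_tmul,
        map_smul, hc]
      split_ifs
      · rw [map_smul, hT, single_smul, smul_mul_smul_comm, hs, smul_smul]
        congr 1
        ring
      · rw [map_zero, single_zero, mul_zero, zero_smul]
  rw [schurProduct, LinearMap.comp_apply, LinearMap.comp_apply, comul_single hα hψ]
  simp only [map_smul, map_sum, key, hψ.counit_comul, AddChar.card_eq, inv_mul_eq_one]
  rw [Finset.sum_eq_single χ, if_pos rfl, smul_smul, inv_mul_cancel_left₀ (by simp),
    singleLinear_apply, single_smul]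
  · intro ξ _ h
    rw [if_neg h, zero_smul]
  · simp

lemma derived_single (hα : ∀ χ b, ψ (α χ b) = ψ b) (hψ : IsQuantumSet ψ)
    {A : G → B →ₗ[ℂ] B} (hA : ∀ g χ b, A g (α χ b) = α χ (A g b)) (b : B) (χ : AddChar G ℂ) :
    derived α ψ A (single α b χ) = single α (fourierComponent A χ b) χ := by
  rw [derived, LinearMap.sum_apply, fourierComponent, LinearMap.sum_apply, single_sum]
  exact Finset.sum_congr rfl fun g _ => schurProduct_X_single hα hψ g (hA g) b χ

lemma derived_coeff (hα : ∀ χ b, ψ (α χ b) = ψ b) (hψ : IsQuantumSet ψ)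
    {A : G → B →ₗ[ℂ] B} (hA : ∀ g χ b, A g (α χ b) = α χ (A g b)) (f : CrossedProduct α)
    (χ : AddChar G ℂ) : (derived α ψ A f).coeff χ = fourierComponent A χ (f.coeff χ) := by
  conv_lhs => rw [← sum_single f]
  simp [derived_single hα hψ hA]

/-- The normalized convolution over the dual group turns into a pointwise product over `G`: summing
over `ξ` kills all mixed Schur products of `A_g` and `A_h` with `g ≠ h`, so these need not vanish
themselves. -/
lemma sum_schurProduct_fourierComponent {A : G → B →ₗ[ℂ] B}
    (hA : ∀ g, schurProduct ψ (A g) (A g) = A g) (χ : AddChar G ℂ) (b : B) :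
    (Fintype.card G : ℂ)⁻¹ • ∑ ξ : AddChar G ℂ,
      schurProduct ψ (fourierComponent A ξ) (fourierComponent A (ξ⁻¹ * χ)) b =
      fourierComponent A χ b := by
  classical
  have key (g h : G) : ∑ ξ : AddChar G ℂ, star (ξ g) * star ((ξ⁻¹ * χ) h) =
      if g = h then (Fintype.card G : ℂ) * star (χ h) else 0 := by
    have := AddChar.sum_apply_eq_ite (h - g)
    simp only [AddChar.mul_apply, star_mul', AddChar.inv_apply, ← mul_assoc, ← Finset.sum_mul]
    have h2 (ξ : AddChar G ℂ) : star (ξ g) * star (ξ (-h)) = ξ (h - g) := by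
      simp [sub_eq_add_neg, AddChar.map_add_eq_mul, AddChar.map_neg_eq_conj, mul_comm]
    simp only [h2, this, sub_eq_zero, eq_comm (a := h), ite_mul, zero_mul]
  have expand (ξ ζ : AddChar G ℂ) :
      schurProduct ψ (fourierComponent A ξ) (fourierComponent A ζ) b =
        ∑ g, ∑ h, (star (ξ g) * star (ζ h)) • schurProduct ψ (A g) (A h) b := by
    simp only [schurProduct, fourierComponent, LinearMap.comp_apply]
    induction comul ψ b with
    | zero => simp
    | add x y hx hy => simp only [map_add, hx, hy, smul_add, Finset.sum_add_distrib]
    | tmul x y =>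
      simp [Finset.sum_mul_sum, smul_smul, LinearMap.sum_apply, mul_comm]
  simp only [expand]
  rw [Finset.sum_comm]
  simp only [Finset.sum_comm (s := (Finset.univ : Finset (AddChar G ℂ))), ← Finset.sum_smul, key]
  simp [Finset.smul_sum, smul_smul, fourierComponent, hA, ite_smul]

lemma isQuantumGraph_derived (hα : ∀ χ b, ψ (α χ b) = ψ b) (hψ : IsQuantumSet ψ)
    {A : G → B →ₗ[ℂ] B} (hA : IsVoltageQuantumGraph α ψ A) :
    IsQuantumGraph (crossedFunctional α ψ) (derived α ψ A) where
  schur_idempotent := by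
    -- The Fourier components commute with the action, so the twist in `m⋆` passes through the
    -- derived graph and cancels on multiplication. What remains is a Schur product on `B`.
    have key (ξ ζ : AddChar G ℂ) (y : B ⊗[ℂ] B) :
        LinearMap.mul' ℂ (CrossedProduct α) (TensorProduct.map (derived α ψ A) (derived α ψ A)
          (TensorProduct.map (singleLinear α ξ)
            (singleLinear α ζ ∘ₗ (α ξ⁻¹).toAlgEquiv.toLinearMap) y)) =
        singleLinear α (ξ * ζ) (LinearMap.mul' ℂ B
          (TensorProduct.map (fourierComponent A ξ) (fourierComponent A ζ) y)) := by
      induction y with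
      | zero => simp
      | add y z hy hz => simp only [map_add, hy, hz]
      | tmul a c =>
        have hc : fourierComponent A ζ (α ξ⁻¹ c) = α ξ⁻¹ (fourierComponent A ζ c) := by
          simp only [fourierComponent, LinearMap.sum_apply, LinearMap.smul_apply, hA.commutes,
            map_sum, map_smul]
        have hc' : (α ξ⁻¹).toAlgEquiv.toLinearMap c = α ξ⁻¹ c := rfl
        simp only [TensorProduct.map_tmul, LinearMap.comp_apply, singleLinear_apply,
          LinearMap.mul'_apply, derived_single hα hψ hA.commutes, single_mul_single, hc', hc,
          action_apply_inv_apply]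
    refine linearMap_ext fun b χ => ?_
    rw [schurProduct, LinearMap.comp_apply, LinearMap.comp_apply, comul_single hα hψ,
      derived_single hα hψ hA.commutes,
      ← sum_schurProduct_fourierComponent (fun g => (hA.isQuantumGraph g).schur_idempotent) χ b]
    simp only [map_smul, map_sum, key, mul_inv_cancel_left, AddChar.card_eq]
    rw [single_smul, single_sum]
    rfl
  star_preserving f := by
    ext χ
    rw [derived_coeff hα hψ hA.commutes, star_coeff, star_coeff, derived_coeff hα hψ hA.commutes]
    -- Passing to `χ⁻¹` and taking the star each conjugate `χ g`, so the two effects cancel.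
    simp [fourierComponent, hA.commutes, (hA.isQuantumGraph _).star_preserving, star_sum,
      AddChar.map_neg_eq_conj]

/-! ### The tensor product model for the trivial action -/

@[simp]
lemma trivEquiv_single (b : B) (χ : AddChar G ℂ) :
    trivEquiv G B (single 1 b χ) = b ⊗ₜ (χ : G → ℂ) := by
  change ∑ ξ : AddChar G ℂ, (single 1 b χ).coeff ξ ⊗ₜ[ℂ] (ξ : G → ℂ) = _
  rw [Finset.sum_eq_single χ] <;> simp +contextual

/-- A nontrivial character sums to `0` over `G` and the trivial one to `n`, which singles out the
coefficient at `1`. -/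
lemma tensorFunctional_trivEquiv (ψ : B →ₗ[ℂ] ℂ) (f : CrossedProduct (1 : AddChar G ℂ →* _)) :
    tensorFunctional G ψ (trivEquiv G B f) = crossedFunctional 1 ψ f := by
  conv_lhs => rw [← sum_single f]
  conv_rhs => rw [← sum_single f]
  simp only [map_sum, trivEquiv_single]
  refine Finset.sum_congr rfl fun χ _ => ?_
  simp only [tensorFunctional, LinearMap.comp_apply, TensorProduct.map_tmul, LinearMap.mul'_apply,
    LinearMap.sum_apply, LinearMap.proj_apply, AddChar.sum_eq_ite, crossedFunctional,
    LinearMap.coe_mk, AddHom.coe_mk, single_coeff, AddChar.card_eq,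
    AddChar.one_eq_zero, eq_comm (a := (0 : AddChar G ℂ))]
  split_ifs <;> simp [mul_comm]

end Derived

open CrossedProduct

/-! ### Matrix units of `L²(G)` -/

section MatrixUnits

variable {G : Type*} [AddCommGroup G] [Fintype G]

lemma inner_charVec (ξ ζ : AddChar G ℂ) :
    inner ℂ (charVec ξ) (charVec ζ) = if ξ = ζ then (Fintype.card G : ℂ) else 0 := by
  have h (g : G) : ζ g * (starRingEnd ℂ) (ξ g) = (ζ - ξ) g := by
    rw [AddChar.sub_apply, AddChar.map_neg_eq_conj]
  simp only [charVec, PiLp.inner_apply, RCLike.inner_apply, h, AddChar.sum_eq_ite, sub_eq_zero,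
    eq_comm (a := ζ)]

lemma matrixUnit_charVec (ξ ζ η : AddChar G ℂ) :
    matrixUnit ξ ζ (charVec η) = if ζ = η then charVec ξ else 0 := by
  simp only [matrixUnit, _root_.smul_apply, InnerProductSpace.rankOne_apply,
    inner_charVec]
  split_ifs <;> simp [smul_smul]

lemma matrixUnit_mul (ξ ζ η θ : AddChar G ℂ) :
    matrixUnit ξ ζ * matrixUnit η θ = if ζ = η then matrixUnit ξ θ else 0 := by
  ext1 v
  simp only [_root_.mul_apply_eq_comp, matrixUnit, _root_.smul_apply,
    InnerProductSpace.rankOne_apply, map_smul, inner_charVec]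
  split_ifs <;> simp [smul_smul]

lemma star_matrixUnit (ξ ζ : AddChar G ℂ) : star (matrixUnit ξ ζ) = matrixUnit ζ ξ := by
  simp [matrixUnit, ContinuousLinearMap.star_eq_adjoint]

variable (G) in
/-- The characters as a basis of `L²(G)`. -/
noncomputable def charBasis : Module.Basis (AddChar G ℂ) ℂ (L2 G) :=
  (AddChar.complexBasis G).map (WithLp.linearEquiv 2 ℂ (G → ℂ)).symm

@[simp]
lemma charBasis_apply (χ : AddChar G ℂ) : charBasis G χ = charVec χ := by
  simp [charBasis, charVec]

lemma sum_matrixUnit : ∑ ζ : AddChar G ℂ, matrixUnit ζ ζ = 1 := by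
  apply ContinuousLinearMap.coe_injective
  refine (charBasis G).ext fun χ => ?_
  simp [matrixUnit_charVec]

end MatrixUnits

/-! ### Homomorphisms between crossed products with values in matrices over `L²(G)` -/

section TwistHom

variable {G : Type*} [AddCommGroup G] [Fintype G]
variable {B : Type*} [Ring B] [StarRing B] [Algebra ℂ B] [StarModule ℂ B]
variable (α β γ : AddChar G ℂ →* (B ≃⋆ₐ[ℂ] B))

/-- The linear map `b u_χ ↦ ∑ ζ, γ_ζ(b) u_χ ⊗ E_{ζ, χ⁻¹ζ}`. -/
noncomputable def twistLinear :
    CrossedProduct α →ₗ[ℂ] CrossedProduct β ⊗[ℂ] (L2 G →L[ℂ] L2 G) :=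
  ∑ χ : AddChar G ℂ, ∑ ζ : AddChar G ℂ,
    (TensorProduct.mk ℂ (CrossedProduct β) (L2 G →L[ℂ] L2 G)).flip (matrixUnit ζ (χ⁻¹ * ζ)) ∘ₗ
      singleLinear β χ ∘ₗ (γ ζ).toAlgEquiv.toLinearMap ∘ₗ coeffLinear α χ

variable {α β γ}

lemma twistLinear_single (b : B) (χ : AddChar G ℂ) :
    twistLinear α β γ (single α b χ) =
      ∑ ζ : AddChar G ℂ, single β (γ ζ b) χ ⊗ₜ[ℂ] matrixUnit ζ (χ⁻¹ * ζ) := by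
  simp only [twistLinear, LinearMap.sum_apply, LinearMap.comp_apply, coeffLinear_apply,
    single_coeff]
  rw [Finset.sum_eq_single χ]
  · simp
  · intro ξ _ h
    simp [h]
  · simp

lemma twistLinear_one : twistLinear α β γ 1 = 1 := by
  rw [one_eq_single, twistLinear_single]
  simp only [map_one, inv_one, one_mul, ← TensorProduct.tmul_sum, sum_matrixUnit]
  rfl

/-- In the product of the images of `b u_χ` and `c u_η`, the matrix units leave `γ_ζ(b)
β_χ(γ_{χ⁻¹ζ}(c))` in row `ζ`. The relation `h` is what turns this into `γ_ζ(b α_χ(c))`. -/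
lemma twistLinear_mul (h : ∀ χ ζ, β χ * γ (χ⁻¹ * ζ) = γ ζ * α χ) (x y : CrossedProduct α) :
    twistLinear α β γ (x * y) = twistLinear α β γ x * twistLinear α β γ y := by
  have key (b c : B) (χ η : AddChar G ℂ) :
      twistLinear α β γ (single α b χ * single α c η) =
        twistLinear α β γ (single α b χ) * twistLinear α β γ (single α c η) := by
    rw [single_mul_single, twistLinear_single, twistLinear_single, twistLinear_single]
    refine Eq.trans ?_
      (Finset.sum_mul_sum (R := CrossedProduct β ⊗[ℂ] (L2 G →L[ℂ] L2 G)) _ _ _ _).symm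
    refine Finset.sum_congr rfl fun ζ _ => ?_
    simp only [Algebra.TensorProduct.tmul_mul_tmul, matrixUnit_mul, single_mul_single]
    rw [Finset.sum_eq_single (χ⁻¹ * ζ)]
    · rw [if_pos rfl, ← StarAlgEquiv.mul_apply (β χ), h, StarAlgEquiv.mul_apply, ← map_mul (γ ζ)]
      congr 2
      simp [mul_assoc, mul_comm]
    · intro θ _ hθ
      rw [if_neg hθ.symm, TensorProduct.tmul_zero]
    · simp
  rw [← sum_single x, ← sum_single y]
  simp only [Finset.sum_mul_sum, map_sum, key]
  exact (Finset.sum_mul_sum (R := CrossedProduct β ⊗[ℂ] (L2 G →L[ℂ] L2 G)) _ _ _ _).symm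

lemma twistLinear_star (h : ∀ χ ζ, β χ * γ (χ⁻¹ * ζ) = γ ζ * α χ) (x : CrossedProduct α) :
    twistLinear α β γ (star x) = star (twistLinear α β γ x) := by
  have key (b : B) (χ : AddChar G ℂ) :
      twistLinear α β γ (star (single α b χ)) = star (twistLinear α β γ (single α b χ)) := by
    rw [star_single, twistLinear_single, twistLinear_single]
    refine Eq.trans ?_ (star_sum (R := CrossedProduct β ⊗[ℂ] (L2 G →L[ℂ] L2 G)) _ _).symm
    -- The star transposes `E_{χζ, ζ}` to `E_{ζ, χζ}`, hence the shift by `χ`; coefficients then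
    -- agree by the relation at `χ⁻¹`.
    refine Fintype.sum_equiv (Equiv.mulLeft χ) _ _ fun ζ => ?_
    have hh := h χ⁻¹ ζ
    rw [inv_inv] at hh
    rw [TensorProduct.star_tmul, star_single, star_matrixUnit, Equiv.coe_mulLeft,
      inv_mul_cancel_left, inv_inv, ← map_star, ← StarAlgEquiv.mul_apply,
      ← StarAlgEquiv.mul_apply, hh]
  have hx : star (∑ χ, single α (x.coeff χ) χ) = ∑ χ, star (single α (x.coeff χ) χ) :=
    star_sum (R := CrossedProduct α) _ _
  rw [← sum_single x, hx, map_sum, map_sum]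
  simp only [key]
  exact (star_sum (R := CrossedProduct β ⊗[ℂ] (L2 G →L[ℂ] L2 G)) _ _).symm

/-- The unital `⋆`-homomorphism `b u_χ ↦ ∑ ζ, γ_ζ(b) u_χ ⊗ E_{ζ, χ⁻¹ζ}`. -/
noncomputable def twistHom (h : ∀ χ ζ, β χ * γ (χ⁻¹ * ζ) = γ ζ * α χ) :
    CrossedProduct α →⋆ₐ[ℂ] CrossedProduct β ⊗[ℂ] (L2 G →L[ℂ] L2 G) where
  toAlgHom := AlgHom.ofLinearMap (twistLinear α β γ) twistLinear_one (twistLinear_mul h)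
  map_star' x := twistLinear_star h x

lemma twistHom_single (h : ∀ χ ζ, β χ * γ (χ⁻¹ * ζ) = γ ζ * α χ) (b : B) (χ : AddChar G ℂ) :
    twistHom h (single α b χ) =
      ∑ ζ : AddChar G ℂ, single β (γ ζ b) χ ⊗ₜ[ℂ] matrixUnit ζ (χ⁻¹ * ζ) :=
  twistLinear_single b χ

/-- Only the row `ζ = χη` acts nontrivially on `e_η`. The resulting shear `(χ, η) ↦ (χ, χη)`,
decorated with automorphisms, carries both bijectivity and the isometry property. -/
lemma isoMap_twistHom_tmul (h : ∀ χ ζ, β χ * γ (χ⁻¹ * ζ) = γ ζ * α χ) (b : B)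
    (χ η : AddChar G ℂ) :
    isoMap (twistHom h) (single α b χ ⊗ₜ charVec η) =
      single β (γ (χ * η) b) χ ⊗ₜ charVec (χ * η) := by
  rw [isoMap_tmul, twistHom_single, map_sum]
  rw [Finset.sum_eq_single (χ * η)]
  · simp [applyVec, matrixUnit_charVec]
  · intro ζ _ hζ
    simp [applyVec, matrixUnit_charVec, inv_mul_eq_iff_eq_mul, hζ]
  · simp

lemma tensor_induction {p : CrossedProduct α ⊗[ℂ] L2 G → Prop}
    (x : CrossedProduct α ⊗[ℂ] L2 G) (zero : p 0) (add : ∀ x y, p x → p y → p (x + y))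
    (tmul : ∀ b χ η, p (single α b χ ⊗ₜ charVec η)) : p x := by
  induction x with
  | zero => exact zero
  | add x y hx hy => exact add x y hx hy
  | tmul f v =>
    have hf : f ⊗ₜ[ℂ] v = ∑ χ, ∑ η,
        single α ((charBasis G).repr v η • f.coeff χ) χ ⊗ₜ[ℂ] charVec η := by
      conv_lhs => rw [← sum_single f, ← (charBasis G).sum_repr v]
      simp only [TensorProduct.sum_tmul, TensorProduct.tmul_sum, charBasis_apply, single_smul,
        TensorProduct.smul_tmul]
      exact Finset.sum_comm
    rw [hf]
    refine Finset.sum_induction _ p add zero fun χ _ => ?_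
    exact Finset.sum_induction _ p add zero fun η _ => tmul _ χ η

variable {ψ : B →ₗ[ℂ] ℂ}

lemma bijective_isoMap_twistHom [FiniteDimensional ℂ B]
    (h : ∀ χ ζ, β χ * γ (χ⁻¹ * ζ) = γ ζ * α χ) : Function.Bijective (isoMap (twistHom h)) := by
  have hs : Function.Surjective (isoMap (twistHom h)) := by
    rw [← LinearMap.range_eq_top, eq_top_iff]
    intro x _
    refine tensor_induction x (zero_mem _) (fun _ _ => add_mem) fun b χ η => ?_
    -- This inverts the shear; injectivity then follows by dimension.
    refine ⟨single α (γ η⁻¹ b) χ ⊗ₜ charVec (χ⁻¹ * η), ?_⟩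
    rw [isoMap_twistHom_tmul, mul_inv_cancel_left, action_apply_inv_apply]
  refine ⟨(LinearMap.injective_iff_surjective_of_finrank_eq_finrank ?_).2 hs, hs⟩
  exact (TensorProduct.congr ((coeffLinearEquiv α).trans (coeffLinearEquiv β).symm)
    (LinearEquiv.refl ℂ (L2 G))).finrank_eq

lemma isQuantumSetIso_twistHom [FiniteDimensional ℂ B]
    (h : ∀ χ ζ, β χ * γ (χ⁻¹ * ζ) = γ ζ * α χ) (hα : ∀ χ b, ψ (α χ b) = ψ b)
    (hβ : ∀ χ b, ψ (β χ b) = ψ b) (hγ : ∀ χ b, ψ (γ χ b) = ψ b) :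
    IsQuantumSetIso (crossedFunctional α ψ) (crossedFunctional β ψ) (twistHom h) where
  bijective := bijective_isoMap_twistHom h
  inner_map_map x y := by
    induction x using tensor_induction with
    | zero => simp
    | add x x' hx hx' => simp only [map_add, LinearMap.add_apply, hx, hx']
    | tmul b χ η =>
    induction y using tensor_induction with
    | zero => simp
    | add y y' hy hy' => simp only [map_add, hy, hy']
    | tmul c ξ ζ =>
    simp only [isoMap_twistHom_tmul, l2Form, tensorForm_tmul, gnsForm_single_right hα,
      gnsForm_single_right hβ, innerₛₗ_apply_apply, inner_charVec, single_coeff]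
    by_cases h1 : ξ = χ
    · subst h1
      by_cases h2 : η = ζ
      · subst h2
        simp [← map_star, ← map_mul, hγ]
      · simp [h2]
    · simp [h1]

/-- Both derived graphs act on `B u_χ` by the same `fourierComponent A χ`, and this commutes with
every `γ_ζ`. -/
lemma isQuantumGraphIso_twistHom {A : G → B →ₗ[ℂ] B} (hψ : IsQuantumSet ψ)
    (h : ∀ χ ζ, β χ * γ (χ⁻¹ * ζ) = γ ζ * α χ) (hα : ∀ χ b, ψ (α χ b) = ψ b)
    (hβ : ∀ χ b, ψ (β χ b) = ψ b) (hγ : ∀ χ b, ψ (γ χ b) = ψ b)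
    (hAα : ∀ g χ b, A g (α χ b) = α χ (A g b)) (hAβ : ∀ g χ b, A g (β χ b) = β χ (A g b))
    (hAγ : ∀ g χ b, A g (γ χ b) = γ χ (A g b)) :
    IsQuantumGraphIso (crossedFunctional α ψ) (derived α ψ A) (crossedFunctional β ψ)
      (derived β ψ A) (twistHom h) where
  toIsQuantumSetIso :=
    have := hψ.finiteDimensional
    isQuantumSetIso_twistHom h hα hβ hγ
  intertwines f := by
    have hc (ξ ζ : AddChar G ℂ) (b : B) :
        fourierComponent A ξ (γ ζ b) = γ ζ (fourierComponent A ξ b) := by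
      simp only [fourierComponent, LinearMap.sum_apply, LinearMap.smul_apply, hAγ, map_sum,
        map_smul]
    rw [← sum_single f]
    simp only [map_sum, derived_single hα hψ hAα, twistHom_single, LinearMap.rTensor_tmul,
      derived_single hβ hψ hAβ, hc]

end TwistHom

/-! ### Change of the source of a quantum isomorphism along a `⋆`-isomorphism. -/

section Comp

variable {B₁ B₂ C : Type*} [Ring B₁] [StarRing B₁] [Algebra ℂ B₁] [StarModule ℂ B₁]
  [Ring B₂] [StarRing B₂] [Algebra ℂ B₂] [StarModule ℂ B₂]
  [Ring C] [StarRing C] [Algebra ℂ C] [StarModule ℂ C]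
  {H : Type*} [NormedAddCommGroup H] [InnerProductSpace ℂ H] [CompleteSpace H]

lemma IsQuantumGraphIso.comp_starAlgEquiv {ψ₁ : B₁ →ₗ[ℂ] ℂ} {A₁ : B₁ →ₗ[ℂ] B₁} {ψ₂ : B₂ →ₗ[ℂ] ℂ}
    {A₂ : B₂ →ₗ[ℂ] B₂} {ρ : B₁ →⋆ₐ[ℂ] B₂ ⊗[ℂ] (H →L[ℂ] H)}
    (hρ : IsQuantumGraphIso ψ₁ A₁ ψ₂ A₂ ρ) {φ : C →ₗ[ℂ] ℂ} (e : B₁ ≃⋆ₐ[ℂ] C)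
    (he : ∀ b, φ (e b) = ψ₁ b) :
    IsQuantumGraphIso φ (e.toAlgEquiv.toLinearMap ∘ₗ A₁ ∘ₗ e.symm.toAlgEquiv.toLinearMap) ψ₂ A₂
      (ρ.comp (e.symm : C →⋆ₐ[ℂ] B₁)) := by
  have hmap : isoMap (ρ.comp (e.symm : C →⋆ₐ[ℂ] B₁)) =
      isoMap ρ ∘ₗ (TensorProduct.congr e.symm.toAlgEquiv.toLinearEquiv
        (LinearEquiv.refl ℂ H)).toLinearMap :=
    TensorProduct.ext' fun _ _ => rfl
  refine { bijective := ?_, inner_map_map := fun x y => ?_, intertwines := fun c => ?_ }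
  · rw [hmap, LinearMap.coe_comp]
    exact hρ.bijective.comp (LinearEquiv.bijective _)
  · rw [hmap, LinearMap.comp_apply, LinearMap.comp_apply, hρ.inner_map_map]
    induction x with
    | zero => simp
    | add x x' hx hx' => simp only [map_add, LinearMap.add_apply, hx, hx']
    | tmul a v =>
      induction y with
      | zero => simp
      | add y y' hy hy' => simp only [map_add, hy, hy']
      | tmul b w =>
        obtain ⟨a, rfl⟩ := EquivLike.surjective e a
        obtain ⟨b, rfl⟩ := EquivLike.surjective e b
        have h := gnsForm_map_starAlgEquiv e he a b
        simp only [gnsForm_apply] at h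
        simp [l2Form, h]
  · have h := hρ.intertwines (e.symm c)
    simpa using h

end Comp

/-! ### Quantum isomorphisms of derived quantum graphs -/

section Main

variable {G : Type u} [AddCommGroup G] [Fintype G]
variable {B : Type v} [Ring B] [StarRing B] [Algebra ℂ B] [StarModule ℂ B]
variable {α : AddChar G ℂ →* (B ≃⋆ₐ[ℂ] B)} {ψ : B →ₗ[ℂ] ℂ} {A : G → B →ₗ[ℂ] B}

lemma trivial_action_invariant (ψ : B →ₗ[ℂ] ℂ) (χ : AddChar G ℂ) (b : B) :
    ψ ((1 : AddChar G ℂ →* (B ≃⋆ₐ[ℂ] B)) χ b) = ψ b := rfl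

lemma IsVoltageQuantumGraph.trivial (hA : IsVoltageQuantumGraph α ψ A) :
    IsVoltageQuantumGraph 1 ψ A :=
  ⟨hA.isQuantumGraph, fun _ _ _ => rfl⟩

lemma isQuantumSet_tensorFunctional (hψ : IsQuantumSet ψ) :
    IsQuantumSet (tensorFunctional G ψ) :=
  (CrossedProduct.isQuantumSet (trivial_action_invariant ψ) hψ).of_starAlgEquiv _
    (tensorFunctional_trivEquiv ψ)

lemma isQuantumGraph_derivedTensor (hψ : IsQuantumSet ψ) (hA : IsVoltageQuantumGraph α ψ A) :
    IsQuantumGraph (tensorFunctional G ψ) (derivedTensor ψ A) :=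
  (isQuantumGraph_derived (trivial_action_invariant ψ) hψ hA.trivial).of_starAlgEquiv
    (CrossedProduct.isQuantumSet (trivial_action_invariant ψ) hψ) _ (tensorFunctional_trivEquiv ψ)

lemma exists_isQuantumGraphIso_derivedTensor (hψ : IsQuantumSet ψ)
    (hα : ∀ χ b, ψ (α χ b) = ψ b) (hA : IsVoltageQuantumGraph α ψ A) :
    ∃ ρ : B ⊗[ℂ] (G → ℂ) →⋆ₐ[ℂ] CrossedProduct α ⊗[ℂ] (L2 G →L[ℂ] L2 G),
      (∀ (b : B) (χ : AddChar G ℂ), ρ (b ⊗ₜ[ℂ] (χ : G → ℂ)) =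
        ∑ ζ : AddChar G ℂ, (u α ζ * ofBase α b * star (u α ζ) * u α χ) ⊗ₜ[ℂ]
          matrixUnit ζ (χ⁻¹ * ζ)) ∧
      IsQuantumGraphIso (tensorFunctional G ψ) (derivedTensor ψ A)
        (crossedFunctional α ψ) (derived α ψ A) ρ := by
  -- The source action is trivial, and the target action itself serves as `γ`.
  have h : ∀ χ ζ, α χ * α (χ⁻¹ * ζ) = α ζ * (1 : AddChar G ℂ →* (B ≃⋆ₐ[ℂ] B)) χ := by
    intro χ ζ
    rw [← map_mul, mul_inv_cancel_left, MonoidHom.one_apply, mul_one]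
  have hρ := (isQuantumGraphIso_twistHom hψ h (trivial_action_invariant ψ) hα hα
    hA.trivial.commutes hA.commutes hA.commutes).comp_starAlgEquiv (trivEquiv G B)
    (tensorFunctional_trivEquiv ψ)
  refine ⟨_, fun b χ => ?_, hρ⟩
  have hs : (trivEquiv G B).symm (b ⊗ₜ[ℂ] (χ : G → ℂ)) = single 1 b χ := by
    rw [← trivEquiv_single, StarAlgEquiv.symm_apply_apply]
  simp only [u_mul_ofBase_mul_star_mul_u]
  exact (congrArg (twistHom h) hs).trans (twistHom_single h b χ)

/-- This direction is opposite to that of `ρ`. Instead of inverting `ρ`, a second twist is used,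
with `γ_ζ = α_{ζ⁻¹}` and trivial target action. -/
lemma quantumIsomorphic_derived (hψ : IsQuantumSet ψ) (hα : ∀ χ b, ψ (α χ b) = ψ b)
    (hA : IsVoltageQuantumGraph α ψ A) :
    QuantumIsomorphic.{u} (crossedFunctional α ψ) (derived α ψ A)
      (crossedFunctional 1 ψ) (derived 1 ψ A) := by
  have h : ∀ χ ζ, (1 : AddChar G ℂ →* (B ≃⋆ₐ[ℂ] B)) χ * (α.comp invMonoidHom) (χ⁻¹ * ζ) =
      (α.comp invMonoidHom) ζ * α χ := by
    intro χ ζ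
    rw [MonoidHom.one_apply, one_mul, MonoidHom.comp_apply, MonoidHom.comp_apply, ← map_mul α]
    simp [mul_comm]
  exact ⟨L2 G, inferInstance, inferInstance, inferInstance, inferInstance, inferInstance,
    twistHom h, isQuantumGraphIso_twistHom hψ h hα (trivial_action_invariant ψ)
      (fun _ _ => hα _ _) hA.commutes hA.trivial.commutes fun _ _ _ => hA.commutes _ _ _⟩

end Main

end QGraph

theorem mainTheorem2 {G : Type u} [AddCommGroup G] [Fintype G]
    {B : Type v} [CStarAlgebra B]
    (ψ : B →ₗ[ℂ] ℂ) (hψ : QGraph.IsQuantumSet ψ)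
    (α : AddChar G ℂ →* (B ≃⋆ₐ[ℂ] B)) (hα : ∀ χ b, ψ (α χ b) = ψ b)
    (A : G → B →ₗ[ℂ] B) (hA : QGraph.IsVoltageQuantumGraph α ψ A) :
    -- the crossed product, with its functional and the derived graph, is a quantum graph
    (QGraph.IsQuantumSet (QGraph.crossedFunctional α ψ) ∧
      QGraph.IsQuantumGraph (QGraph.crossedFunctional α ψ) (QGraph.derived α ψ A)) ∧
    -- so is the tensor product quantum set with the derived graph for the trivial action,
    -- and the identification of the two models for the trivial action preserves the functionals
    (QGraph.IsQuantumSet (QGraph.tensorFunctional G ψ) ∧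
      QGraph.IsQuantumGraph (QGraph.tensorFunctional G ψ) (QGraph.derivedTensor ψ A) ∧
      ∀ f, QGraph.tensorFunctional G ψ (QGraph.trivEquiv G B f) =
        QGraph.crossedFunctional 1 ψ f) ∧
    -- the explicit map `ρ` is a quantum isomorphism between these quantum graphs
    (∃ ρ : B ⊗[ℂ] (G → ℂ) →⋆ₐ[ℂ]
        QGraph.CrossedProduct α ⊗[ℂ] (QGraph.L2 G →L[ℂ] QGraph.L2 G),
      (∀ (b : B) (χ : AddChar G ℂ), ρ (b ⊗ₜ[ℂ] (χ : G → ℂ)) =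
        ∑ ζ : AddChar G ℂ,
          (QGraph.CrossedProduct.u α ζ * QGraph.CrossedProduct.ofBase α b *
            star (QGraph.CrossedProduct.u α ζ) * QGraph.CrossedProduct.u α χ) ⊗ₜ[ℂ]
          QGraph.matrixUnit ζ (χ⁻¹ * ζ)) ∧
      QGraph.IsQuantumGraphIso (QGraph.tensorFunctional G ψ) (QGraph.derivedTensor ψ A)
        (QGraph.crossedFunctional α ψ) (QGraph.derived α ψ A) ρ) ∧
    -- the derived quantum graph is quantum isomorphic to the one for the trivial action
    QGraph.QuantumIsomorphic.{u}
      (QGraph.crossedFunctional α ψ) (QGraph.derived α ψ A)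
      (QGraph.crossedFunctional 1 ψ) (QGraph.derived 1 ψ A) :=
  ⟨⟨QGraph.CrossedProduct.isQuantumSet hα hψ, QGraph.isQuantumGraph_derived hα hψ hA⟩,
    ⟨QGraph.isQuantumSet_tensorFunctional hψ, QGraph.isQuantumGraph_derivedTensor hψ hA,
      QGraph.tensorFunctional_trivEquiv ψ⟩,
    QGraph.exists_isQuantumGraphIso_derivedTensor hψ hα hA,
    QGraph.quantumIsomorphic_derived hψ hα hA⟩
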